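/- **Setting.** For an integer $N\ge 1$, $\alpha\in(0,1)$, an integer $b\ge 2$ and a constant $\epsilon>0$ (not depending on $N$), consider $N$ servers with exponential service rates $\mu_1\ge\mu_2\ge\dots\ge\mu_N\ge\epsilon$, normalized by $\sum_{n=1}^N\mu_n=N$. Jobs arrive in a Poisson process of rate $\lambda N$ with $\lambda=1-N^{-\alpha}$. Each server serves its queue in FIFO order and holds at most $b$ jobs (one in service and $b-1$ waiting). Under Join-the-Fastest-Shortest-Queue (JFSQ) an arriving job is routed to a server with the smallest number of jobs; among those to one with the largest service rate; remaining ties are broken uniformly at random. A job routed to a server with $b$ jobs is blocked (lost). Assume that there is an index $N_2$ with $\sum_{n=1}^{N_2}\mu_n=\lambda N$. Let $p_{\mathcal W}$ be the steady-state probability that an arriving job is routed to a busy server, $p_{\mathcal B}$ the steady-state probability that it is blocked, and $W$ the steady-state waiting time (before service starts) of a job that is not blocked. Fix $r>0$ and put $$k_{sub}=\frac{16(b-1)\mu_{N_2}}{\epsilon^2},\qquad k_{super}=\frac{24\,r\,(b-1)\mu_1}{\epsilon}.$$ *Sub-Halfin–Whitt condition:* $\alpha\in(0,\tfrac12)$ and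 $$\max\Big\{\frac{2(r+1)}{\log N},\ \frac{27(r+1)\,b\log N}{N^{1/4-\alpha/2}}\Big\}\le\epsilon\le\frac12,\qquad \frac{\mu_1}{\epsilon^2}\le\frac{N^{1-\alpha}}{64\,b\,(2\log^2N+3)}.$$ *Super-Halfin–Whitt condition:* $\alpha\in[\tfrac12,1)$ and $$\frac{\mu_1}{\epsilon}\le\frac{N^{1-\alpha}}{24\,r\,b\log^2N}.$$ **Theorem.** For every $r>0$ there is a constant $C>0$, depending only on $r$, such that for all $\alpha\in(0,1)$, $b\ge2$ and $\epsilon>0$ there is $N_0$ such that for all $N\ge N_0$, all service rates $\mu_1,\dots,\mu_N$ as above and every stationary distribution of the JFSQ queue-length Markov chain the following holds. 1) If the Sub-Halfin–Whitt condition holds, then $p_{\mathcal B}<1$, $W$ is integrable, and $$\mathbb E[W]\le C\Big(\frac1{N^\alpha}+\frac{k_{sub}}{N^{1-\alpha}}\Big),\qquad p_{\mathcal W}\le C\Big(\frac{k_{sub}}{N^{1-\alpha}}+\frac{\log N}{\sqrt N}\Big).$$ 2) If the Super-Halfin–Whitt condition holds, then $p_{\mathcal B}<1$, $W$ is integrable,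 and $$\mathbb E[W]\le C\Big(\frac{k_{super}\log N}{N^{1-\alpha}}+\frac{\log N}{\sqrt N}\Big),\qquad p_{\mathcal W}\le C\,\frac{k_{super}\log N}{N^{1-\alpha}}.$$ -/

import Mathlib

open MeasureTheory ProbabilityTheory

noncomputable section

namespace JFSQ

/-- Queue-length vectors `(q_1, …, q_N)`; `q n` counts all jobs at server `n`, including the one in
service, and is at most `b` (one job in service and `b - 1` waiting places). -/
abbrev State (N b : ℕ) : Type := Fin N → Fin (b + 1)

variable {N b : ℕ}

/-- The load `λ = 1 - N ^ (-α)`. -/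
def load (N : ℕ) (α : ℝ) : ℝ := 1 - (N : ℝ) ^ (-α)

/-- The servers with the shortest queue. -/
def shortest (q : State N b) : Finset (Fin N) :=
  Finset.univ.filter fun n => ∀ m, q n ≤ q m

/-- The fastest servers among those with the shortest queue. -/
def targets (μ : Fin N → ℝ) (q : State N b) : Finset (Fin N) :=
  (shortest q).filter fun n => ∀ m ∈ shortest q, μ m ≤ μ n

/-- The probability that Join-the-Fastest-Shortest-Queue routes a job arriving in state `q` to
server `n`: uniform over the fastest of the servers with the shortest queue. -/
def route (μ : Fin N → ℝ) (q : State N b) (n : Fin N) : ℝ :=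
  if n ∈ targets μ q then ((targets μ q).card : ℝ)⁻¹ else 0

/-- The state after an arrival routed to server `n`; the job is discarded if that server already
holds `b` jobs. -/
def arrive (q : State N b) (n : Fin N) : State N b :=
  if h : (q n : ℕ) < b then Function.update q n ⟨(q n : ℕ) + 1, Nat.succ_lt_succ h⟩ else q

/-- The state after a service completion at server `n`; nothing happens if server `n` is idle. -/
def depart (q : State N b) (n : Fin N) : State N b :=
  Function.update q n ⟨(q n : ℕ) - 1, lt_of_le_of_lt (Nat.sub_le _ _) (q n).isLt⟩

/-- The generator of the queue-length Markov chain under JFSQ, with Poisson arrivals of rate `λ N`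
and exponential service of rate `μ n` at each server `n`. -/
def generator (α : ℝ) (μ : Fin N → ℝ) (f : State N b → ℝ) (q : State N b) : ℝ :=
  (∑ n, load N α * N * route μ q n * (f (arrive q n) - f q)) +
    ∑ n, (if 1 ≤ (q n : ℕ) then μ n else 0) * (f (depart q n) - f q)

/-- `π` is a stationary distribution of the queue-length Markov chain under JFSQ. -/
structure IsStationary (α : ℝ) (μ : Fin N → ℝ) (π : State N b → ℝ) : Prop where
  nonneg : ∀ q, 0 ≤ π q
  sum_eq_one : ∑ q, π q = 1
  balance : ∀ f : State N b → ℝ, ∑ q, π q * generator α μ f q = 0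

/-- The probability that a job arriving in steady state is routed to a busy server. -/
def waitProb (μ : Fin N → ℝ) (π : State N b → ℝ) : ℝ :=
  ∑ q, ∑ n, if 1 ≤ (q n : ℕ) then π q * route μ q n else 0

/-- The probability that a job arriving in steady state is blocked, i.e. routed to a server that
holds `b` jobs. -/
def blockProb (μ : Fin N → ℝ) (π : State N b → ℝ) : ℝ :=
  ∑ q, ∑ n, if (q n : ℕ) = b then π q * route μ q n else 0

/-- The law of the sum of `k` independent exponential times of rate `ρ`. -/
def erlang (k : ℕ) (ρ : ℝ) : Measure ℝ :=
  (Measure.pi fun _ : Fin k => expMeasure ρ).map fun s => ∑ i, s i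

/-- The law of the waiting time (in the buffer, before service starts) of a job that arrives in
steady state, conditioned on not being blocked. A job that joins server `n` behind `k` jobs waits,
under FIFO, for one residual and `k - 1` full service times, which by memorylessness are `k`
independent exponential times of rate `μ n`. -/
def waitLaw (μ : Fin N → ℝ) (π : State N b → ℝ) : Measure ℝ :=
  ∑ q, ∑ n, if (q n : ℕ) < b then
    ENNReal.ofReal (π q * route μ q n / (1 - blockProb μ π)) • erlang (q n : ℕ) (μ n) else 0

/-- Normalized, decreasingly ordered service rates, bounded below by `ε`, such that the fastest
servers up to and including `n₂` have total capacity exactly `λ N`. -/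
structure Rates (α ε : ℝ) (μ : Fin N → ℝ) (n₂ : Fin N) : Prop where
  antitone : Antitone μ
  lower : ∀ n, ε ≤ μ n
  total : ∑ n, μ n = N
  critical : ∑ n ∈ Finset.Iic n₂, μ n = load N α * N

/-- The condition on the system in the Sub-Halfin–Whitt regime; `μ₁` is the largest rate. -/
structure SubAssumption (N b : ℕ) (α r ε μ₁ : ℝ) : Prop where
  regime : 0 < α ∧ α < 1 / 2
  lower : max (2 * (r + 1) / Real.log N)
    (27 * (r + 1) * b * Real.log N / (N : ℝ) ^ (1 / 4 - α / 2 : ℝ)) ≤ ε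
  upper : ε ≤ 1 / 2
  fastest : μ₁ / ε ^ 2 ≤ (N : ℝ) ^ (1 - α) / (64 * b * (2 * Real.log N ^ 2 + 3))

/-- The condition on the system in the Super-Halfin–Whitt regime; `μ₁` is the largest rate. -/
structure SuperAssumption (N b : ℕ) (α r ε μ₁ : ℝ) : Prop where
  regime : 1 / 2 ≤ α ∧ α < 1
  fastest : μ₁ / ε ≤ (N : ℝ) ^ (1 - α) / (24 * r * b * Real.log N ^ 2)

/-- The heterogeneity parameter of the Sub-Halfin–Whitt regime; `m` is the rate of the critical
server. -/
def kSub (b : ℕ) (ε m : ℝ) : ℝ := 16 * ((b : ℝ) - 1) * m / ε ^ 2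

/-- The heterogeneity parameter of the Super-Halfin–Whitt regime; `m` is the largest rate. -/
def kSuper (b : ℕ) (r ε m : ℝ) : ℝ := 24 * r * ((b : ℝ) - 1) * m / ε

end JFSQ

end

/-!
The generator is tested against quadratic and exponential functions of two statistics of the queue
lengths: the number `I` of idle servers and the number `Q` of jobs in the buffers. Let
`D = N ^ (1 - α)` be the spare capacity. Since the mean speed is one and no server is slower than
`ε`, the servers faster than `2` cannot carry the arrival stream alone, and every arrival goes to an
idle fast server if there is one. Hence the fast servers are almost never idle, the idle capacity,
which has mean at least `D`, comes from servers of speed at most `2`, and so `I` stays of order `D`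
or more.

A job waits only if `I = 0`. For `α < 1 / 2` the test function `exp (-θ I)` with `θ` of order
`D / N` makes this probability exponentially small in `D ^ 2 / N = N ^ (1 - 2 α)`. For `1 / 2 ≤ α`
the test functions `I ^ 2 / 2`, `(Q - I) ^ 2 / 2` and `Q * J ^ 2 / 2`, where `J` counts the idle
fast servers, bound the mean number of buffered jobs by a multiple of `N / D`, and a linear test
function turns this into a bound on the probability of waiting. Finally, a job that waits does so
for at most `b` services of mean at most `1 / ε`.
-/

noncomputable section

namespace JFSQ

/-! ### Idle servers, buffered jobs and the generator -/

section

variable {N b : ℕ} {α : ℝ} {μ : Fin N → ℝ} {F : Finset (Fin N)}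
  {q : State N b} {n : Fin N}

/-- The total rate `λ N` of the arrival process. -/
def arrivalRate (N : ℕ) (α : ℝ) : ℝ := load N α * N

/-- The number of idle servers in `F`, a real number since it enters test functions for the
generator. -/
def idle (F : Finset (Fin N)) (q : State N b) : ℝ := ∑ n ∈ F, if (q n : ℕ) = 0 then 1 else 0

/-- The number of jobs in the buffers; truncated subtraction discounts the job in service. -/
def waiting (q : State N b) : ℝ := ∑ n, (((q n : ℕ) - 1 : ℕ) : ℝ)

/-- The total service rate of the idle servers. -/
def idleRate (μ : Fin N → ℝ) (q : State N b) : ℝ := ∑ n, if (q n : ℕ) = 0 then μ n else 0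

/-- The rate at which servers of `F` become idle. -/
def singleRate (μ : Fin N → ℝ) (F : Finset (Fin N)) (q : State N b) : ℝ :=
  ∑ n ∈ F, if (q n : ℕ) = 1 then μ n else 0

/-- The rate at which jobs leave the buffers. -/
def queueRate (μ : Fin N → ℝ) (q : State N b) : ℝ := ∑ n, if 2 ≤ (q n : ℕ) then μ n else 0

theorem idle_nonneg (F : Finset (Fin N)) (q : State N b) : 0 ≤ idle F q :=
  Finset.sum_nonneg fun _ _ => by split_ifs <;> norm_num

theorem waiting_nonneg (q : State N b) : 0 ≤ waiting q :=
  Finset.sum_nonneg fun _ _ => Nat.cast_nonneg _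

theorem idleRate_nonneg (hμ : ∀ n, 0 ≤ μ n) (q : State N b) : 0 ≤ idleRate μ q :=
  Finset.sum_nonneg fun n _ => ite_nonneg (hμ n) le_rfl

theorem singleRate_nonneg (hμ : ∀ n, 0 ≤ μ n) (F : Finset (Fin N)) (q : State N b) :
    0 ≤ singleRate μ F q :=
  Finset.sum_nonneg fun n _ => ite_nonneg (hμ n) le_rfl

theorem queueRate_nonneg (hμ : ∀ n, 0 ≤ μ n) (q : State N b) : 0 ≤ queueRate μ q :=
  Finset.sum_nonneg fun n _ => ite_nonneg (hμ n) le_rfl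

theorem singleRate_le_sum (hμ : ∀ n, 0 ≤ μ n) (F : Finset (Fin N)) (q : State N b) :
    singleRate μ F q ≤ ∑ n ∈ F, μ n :=
  Finset.sum_le_sum fun n _ => by split_ifs; exacts [le_rfl, hμ n]

theorem idleRate_add_singleRate_add_queueRate (μ : Fin N → ℝ) (q : State N b) :
    idleRate μ q + singleRate μ Finset.univ q + queueRate μ q = ∑ n, μ n := by
  simp only [idleRate, singleRate, queueRate, ← Finset.sum_add_distrib]
  refine Finset.sum_congr rfl fun n _ => ?_
  rcases (q n : ℕ) with _ | _ | k <;> simp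

theorem idle_eq_zero_iff : idle F q = 0 ↔ ∀ n ∈ F, (q n : ℕ) ≠ 0 := by
  rw [idle, Finset.sum_boole, Nat.cast_eq_zero, Finset.card_eq_zero, Finset.filter_eq_empty_iff]

theorem idle_ne_zero_iff : idle F q ≠ 0 ↔ ∃ n ∈ F, (q n : ℕ) = 0 := by
  rw [Ne, idle_eq_zero_iff]
  push Not
  rfl

theorem idleRate_eq_zero (h : idle Finset.univ q = 0) : idleRate μ q = 0 :=
  Finset.sum_eq_zero fun n hn => if_neg (idle_eq_zero_iff.mp h n hn)

theorem mul_idle_le_idleRate {ε : ℝ} (h : ∀ n, ε ≤ μ n) (q : State N b) :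
    ε * idle Finset.univ q ≤ idleRate μ q := by
  rw [idle, idleRate, Finset.mul_sum]
  gcongr with n
  split_ifs
  · simpa only [mul_one] using h n
  · simp only [mul_zero, le_refl]

theorem idleRate_le {c m : ℝ} (hc : 0 ≤ c) (hF : ∀ n ∉ F, μ n ≤ c) (hm : ∀ n, μ n ≤ m)
    (q : State N b) : idleRate μ q ≤ c * idle Finset.univ q + m * idle F q := by
  have hidle : idle F q =
      ∑ n, if n ∈ F then (if (q n : ℕ) = 0 then 1 else 0) else 0 := by
    rw [idle, Finset.sum_ite_mem, Finset.univ_inter]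
  rw [hidle, idle, idleRate, Finset.mul_sum, Finset.mul_sum, ← Finset.sum_add_distrib]
  gcongr with n
  by_cases hn : n ∈ F
  · split_ifs <;> linarith [hm n]
  · split_ifs <;> linarith [hF n hn]

theorem queueRate_le {m : ℝ} (hm0 : 0 ≤ m) (hm : ∀ n, μ n ≤ m) (q : State N b) :
    queueRate μ q ≤ m * waiting q := by
  rw [queueRate, waiting, Finset.mul_sum]
  gcongr with n
  split_ifs with h
  · have : (1 : ℝ) ≤ (((q n : ℕ) - 1 : ℕ) : ℝ) := by exact_mod_cast Nat.le_sub_of_add_le h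
    exact (hm n).trans (le_mul_of_one_le_right hm0 this)
  · positivity

theorem mul_waiting_le {ε : ℝ} (hε : 0 ≤ ε) (h : ∀ n, ε ≤ μ n) (q : State N b) :
    ε * waiting q ≤ b * queueRate μ q := by
  rw [queueRate, waiting, Finset.mul_sum, Finset.mul_sum]
  refine Finset.sum_le_sum fun n _ => ?_
  split_ifs with h2
  · have hqb : (((q n : ℕ) - 1 : ℕ) : ℝ) ≤ b := by exact_mod_cast (by omega : (q n : ℕ) - 1 ≤ b)
    rw [mul_comm]
    exact mul_le_mul hqb (h n) hε b.cast_nonneg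
  · simp [show (q n : ℕ) - 1 = 0 by omega]

theorem sum_update (φ : Fin (b + 1) → ℝ) (F : Finset (Fin N)) (q : State N b) (n : Fin N)
    (v : Fin (b + 1)) :
    ∑ m ∈ F, φ (Function.update q n v m) =
      ∑ m ∈ F, φ (q m) + if n ∈ F then φ v - φ (q n) else 0 := by
  rw [← sub_eq_iff_eq_add', ← Finset.sum_sub_distrib,
    ← Finset.sum_ite_eq' F n fun m => φ v - φ (q m)]
  refine Finset.sum_congr rfl fun m _ => ?_
  rcases eq_or_ne m n with rfl | h
  · simp
  · simp [h]

theorem idle_arrive (hb : 1 ≤ b) (F : Finset (Fin N)) (q : State N b) (n : Fin N) :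
    idle F (arrive q n) = idle F q - if n ∈ F ∧ (q n : ℕ) = 0 then 1 else 0 := by
  unfold arrive
  split_ifs with h h0 h0
  · exact (sum_update (fun k => if (k : ℕ) = 0 then 1 else 0) F q n _).trans <| by
      simp [idle, h0, sub_eq_add_neg]
  · refine (sum_update (fun k => if (k : ℕ) = 0 then 1 else 0) F q n _).trans ?_
    by_cases hn : n ∈ F
    · simp [idle, hn, show (q n : ℕ) ≠ 0 from fun h' => h0 ⟨hn, h'⟩]
    · simp [idle, hn]
  · omega
  · rw [sub_zero]

theorem waiting_arrive (q : State N b) (n : Fin N) :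
    waiting (arrive q n) = waiting q + if 1 ≤ (q n : ℕ) ∧ (q n : ℕ) < b then 1 else 0 := by
  unfold arrive
  split_ifs with h h0 h0
  · exact (sum_update (fun k => (((k : ℕ) - 1 : ℕ) : ℝ)) Finset.univ q n _).trans <| by
      simp [waiting, Nat.cast_sub h0.1]
  · exact (sum_update (fun k => (((k : ℕ) - 1 : ℕ) : ℝ)) Finset.univ q n _).trans <| by
      simp [waiting, show (q n : ℕ) = 0 by omega]
  · omega
  · rw [add_zero]

theorem idle_depart (F : Finset (Fin N)) (q : State N b) (hn : 1 ≤ (q n : ℕ)) :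
    idle F (depart q n) = idle F q + if n ∈ F ∧ (q n : ℕ) = 1 then 1 else 0 := by
  refine (sum_update (fun k => if (k : ℕ) = 0 then 1 else 0) F q n _).trans ?_
  have h0 : (q n : ℕ) ≠ 0 := by omega
  have h1 : (q n : ℕ) - 1 = 0 ↔ (q n : ℕ) = 1 := by omega
  by_cases hF : n ∈ F <;> simp [idle, hF, h0, h1]

theorem waiting_depart (q : State N b) (n : Fin N) :
    waiting (depart q n) = waiting q - if 2 ≤ (q n : ℕ) then 1 else 0 := by
  refine (sum_update (fun k => (((k : ℕ) - 1 : ℕ) : ℝ)) Finset.univ q n _).trans ?_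
  rw [if_pos (Finset.mem_univ n)]
  split_ifs with h
  · have hpred : (((q n : ℕ) - 1 - 1 : ℕ) : ℝ) = ((q n : ℕ) - 1 : ℕ) - 1 :=
      Nat.cast_pred (by omega)
    simp only [hpred, waiting]
    ring
  · simp [waiting, show (q n : ℕ) - 1 = 0 by omega]

/-- A set of servers that contains, with each server, all servers that are at least as fast; an
arriving job that finds a server of such a set idle joins the set. -/
def IsFastest (μ : Fin N → ℝ) (F : Finset (Fin N)) : Prop :=
  ∀ n ∈ F, ∀ m, μ n ≤ μ m → m ∈ F

theorem isFastest_univ (μ : Fin N → ℝ) : IsFastest μ Finset.univ :=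
  fun _ _ m _ => Finset.mem_univ m

theorem le_of_mem_targets (hn : n ∈ targets μ q) (m : Fin N) : q n ≤ q m := by
  simp only [targets, shortest, Finset.mem_filter] at hn
  exact hn.1.2 m

theorem eq_zero_of_mem_targets (hn : n ∈ targets μ q) (h : idle F q ≠ 0) : (q n : ℕ) = 0 := by
  obtain ⟨m, -, hm⟩ := idle_ne_zero_iff.mp h
  exact Nat.le_zero.mp (hm ▸ le_of_mem_targets hn m)

theorem IsFastest.mem_of_mem_targets (hF : IsFastest μ F) (hn : n ∈ targets μ q)
    (h : idle F q ≠ 0) : n ∈ F := by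
  obtain ⟨m, hmF, hm⟩ := idle_ne_zero_iff.mp h
  refine hF m hmF n ((Finset.mem_filter.mp hn).2 m ?_)
  exact Finset.mem_filter.mpr ⟨Finset.mem_univ m, fun k => by rw [Fin.le_def, hm]; omega⟩

theorem route_nonneg (μ : Fin N → ℝ) (q : State N b) (n : Fin N) : 0 ≤ route μ q n := by
  unfold route; split_ifs <;> positivity

theorem targets_nonempty [NeZero N] (μ : Fin N → ℝ) (q : State N b) : (targets μ q).Nonempty := by
  obtain ⟨k, -, hk⟩ := Finset.exists_min_image Finset.univ q ⟨0, Finset.mem_univ _⟩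
  have hk : k ∈ shortest q := Finset.mem_filter.mpr ⟨Finset.mem_univ k, fun m => hk m (by simp)⟩
  obtain ⟨n, hn, h⟩ := Finset.exists_max_image (shortest q) μ ⟨k, hk⟩
  exact ⟨n, Finset.mem_filter.mpr ⟨hn, h⟩⟩

theorem sum_route [NeZero N] (μ : Fin N → ℝ) (q : State N b) : ∑ n, route μ q n = 1 := by
  have h : ((targets μ q).card : ℝ) ≠ 0 := by
    exact_mod_cast (targets_nonempty μ q).card_pos.ne'
  simp [route, h]

theorem sum_route_mul_le [NeZero N] {a : ℝ} {g : Fin N → ℝ} (h : ∀ n ∈ targets μ q, g n ≤ a) :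
    ∑ n, route μ q n * g n ≤ a := by
  calc ∑ n, route μ q n * g n ≤ ∑ n, route μ q n * a := by
        refine Finset.sum_le_sum fun n _ => ?_
        by_cases hn : n ∈ targets μ q
        · exact mul_le_mul_of_nonneg_left (h n hn) (route_nonneg _ _ _)
        · simp [route, hn]
    _ = a := by rw [← Finset.sum_mul, sum_route, one_mul]

theorem sum_depart (φ : ℝ → ℝ → ℝ) (μ : Fin N → ℝ) (F : Finset (Fin N)) (q : State N b) :
    ∑ n, (if 1 ≤ (q n : ℕ) then μ n else 0) *
        (φ (waiting (depart q n)) (idle F (depart q n)) - φ (waiting q) (idle F q)) =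
      singleRate μ F q * (φ (waiting q) (idle F q + 1) - φ (waiting q) (idle F q)) +
        queueRate μ q * (φ (waiting q - 1) (idle F q) - φ (waiting q) (idle F q)) := by
  have hsingle : singleRate μ F q =
      ∑ n, if n ∈ F then (if (q n : ℕ) = 1 then μ n else 0) else 0 := by
    rw [singleRate, Finset.sum_ite_mem, Finset.univ_inter]
  rw [hsingle, queueRate, Finset.sum_mul, Finset.sum_mul, ← Finset.sum_add_distrib]
  refine Finset.sum_congr rfl fun n _ => ?_
  rcases Nat.eq_zero_or_pos (q n : ℕ) with h | h
  · simp [h]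
  · rw [waiting_depart, idle_depart F q h]
    rcases Nat.lt_or_eq_of_le (Nat.succ_le_of_lt h) with h2 | h1
    · simp [show 1 ≤ (q n : ℕ) from h, show (q n : ℕ) ≠ 1 by omega, show 2 ≤ (q n : ℕ) from h2]
    · by_cases hn : n ∈ F <;> simp [← h1, hn]

theorem generator_le [NeZero N] (hΛ : 0 ≤ arrivalRate N α) (φ : ℝ → ℝ → ℝ) {a : ℝ}
    (ha : ∀ n ∈ targets μ q,
      φ (waiting (arrive q n)) (idle F (arrive q n)) - φ (waiting q) (idle F q) ≤ a) :
    generator α μ (fun q => φ (waiting q) (idle F q)) q ≤ arrivalRate N α * a +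
      (singleRate μ F q * (φ (waiting q) (idle F q + 1) - φ (waiting q) (idle F q)) +
        queueRate μ q * (φ (waiting q - 1) (idle F q) - φ (waiting q) (idle F q))) := by
  rw [generator, sum_depart]
  gcongr
  simp_rw [mul_assoc (load N α * N)]
  rw [← Finset.mul_sum]
  exact mul_le_mul_of_nonneg_left (sum_route_mul_le ha) hΛ

theorem IsFastest.generator_le_of_idle_ne_zero [NeZero N] (hF : IsFastest μ F) (hb : 1 ≤ b)
    (hΛ : 0 ≤ arrivalRate N α) (h : idle F q ≠ 0) (φ : ℝ → ℝ → ℝ) :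
    generator α μ (fun q => φ (waiting q) (idle F q)) q ≤
      arrivalRate N α * (φ (waiting q) (idle F q - 1) - φ (waiting q) (idle F q)) +
      (singleRate μ F q * (φ (waiting q) (idle F q + 1) - φ (waiting q) (idle F q)) +
        queueRate μ q * (φ (waiting q - 1) (idle F q) - φ (waiting q) (idle F q))) :=
  generator_le hΛ φ fun n hn => by
    simp [waiting_arrive, idle_arrive hb, hF.mem_of_mem_targets hn h, eq_zero_of_mem_targets hn h]

theorem generator_le_of_idle_eq_zero [NeZero N] (hb : 1 ≤ b)
    (hΛ : 0 ≤ arrivalRate N α) (h : idle F q = 0) (φ : ℝ → ℝ → ℝ) :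
    generator α μ (fun q => φ (waiting q) (idle F q)) q ≤
      arrivalRate N α * max 0 (φ (waiting q + 1) 0 - φ (waiting q) 0) +
      (singleRate μ F q * (φ (waiting q) 1 - φ (waiting q) 0) +
        queueRate μ q * (φ (waiting q - 1) 0 - φ (waiting q) 0)) := by
  refine (generator_le hΛ φ (a := max 0 (φ (waiting q + 1) 0 - φ (waiting q) 0))
    fun n _ => ?_).trans_eq (by rw [h, zero_add])
  have hn : ¬(n ∈ F ∧ (q n : ℕ) = 0) := fun hn => idle_eq_zero_iff.mp h n hn.1 hn.2
  rw [waiting_arrive, idle_arrive hb, if_neg hn, h, sub_zero]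
  split_ifs
  · exact le_max_right _ _
  · simp only [add_zero, sub_self, le_max_left]

end

/-! ### Drift inequalities -/

section

variable {N b : ℕ} {α σ : ℝ} {μ : Fin N → ℝ} {F : Finset (Fin N)}

/-- The capacity in excess of the arrival rate. -/
def spareRate (α : ℝ) (μ : Fin N → ℝ) : ℝ := ∑ n, μ n - arrivalRate N α

theorem exp_neg_sub_one_le {x : ℝ} (hx0 : 0 ≤ x) (hx1 : x ≤ 1) :
    Real.exp (-x) - 1 ≤ -x + x ^ 2 := by
  have h := (abs_le.mp (Real.abs_exp_sub_one_sub_id_le (x := -x)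
    (by rwa [abs_neg, abs_of_nonneg hx0]))).2
  linarith [neg_sq x]

theorem exp_sub_one_le {x : ℝ} (hx0 : 0 ≤ x) (hx1 : x ≤ 1) : Real.exp x - 1 ≤ x + x ^ 2 := by
  linarith [(abs_le.mp (Real.abs_exp_sub_one_sub_id_le (x := x) (by rwa [abs_of_nonneg hx0]))).2]

theorem generator_idle_sq_le [NeZero N] (hb : 1 ≤ b) (hμ : ∀ n, 0 ≤ μ n)
    (hΛ : 0 ≤ arrivalRate N α) (hD : 0 ≤ spareRate α μ) (q : State N b) :
    generator α μ (fun q => idle Finset.univ q ^ 2 / 2) q ≤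
      idle Finset.univ q * (spareRate α μ - idleRate μ q - queueRate μ q) + ∑ n, μ n := by
  have hrate := idleRate_add_singleRate_add_queueRate μ q
  have hS := singleRate_le_sum hμ Finset.univ q
  rw [spareRate] at *
  by_cases h : idle Finset.univ q = 0
  · have hgen := generator_le_of_idle_eq_zero (μ := μ) hb hΛ h fun _ i => i ^ 2 / 2
    rw [sub_self, max_self] at hgen
    rw [h]
    linarith [singleRate_nonneg hμ Finset.univ q]
  · have hgen := (isFastest_univ μ).generator_le_of_idle_ne_zero hb hΛ h fun _ i => i ^ 2 / 2
    linear_combination hgen + idle Finset.univ q * hrate + hS / 2 + hD / 2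

theorem generator_waiting_sub_idle_sq_le [NeZero N] (hb : 1 ≤ b) (hμ : ∀ n, 0 ≤ μ n)
    (hΛ : 0 ≤ arrivalRate N α) (hD : 0 ≤ spareRate α μ) (q : State N b) :
    generator α μ (fun q => (waiting q - idle Finset.univ q) ^ 2 / 2) q ≤
      (waiting q - idle Finset.univ q) * (idleRate μ q - spareRate α μ) + ∑ n, μ n := by
  have hrate := idleRate_add_singleRate_add_queueRate μ q
  have hZ := idleRate_nonneg hμ q
  rw [spareRate] at *
  by_cases h : idle Finset.univ q = 0
  · have hgen := generator_le_of_idle_eq_zero (μ := μ) hb hΛ h fun w i => (w - i) ^ 2 / 2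
    have hmax : max 0 ((waiting q + 1 - 0) ^ 2 / 2 - (waiting q - 0) ^ 2 / 2) =
        waiting q + 1 / 2 := by
      rw [max_eq_right] <;> nlinarith [waiting_nonneg q]
    rw [hmax] at hgen
    rw [h]
    linear_combination hgen - (waiting q - 1 / 2) * hrate + hD / 2 + hZ / 2
  · have hgen := (isFastest_univ μ).generator_le_of_idle_ne_zero hb hΛ h
      fun w i => (w - i) ^ 2 / 2
    linear_combination hgen - (waiting q - idle Finset.univ q - 1 / 2) * hrate + hD / 2 + hZ / 2

theorem IsFastest.generator_waiting_mul_idle_sq_le [NeZero N] (hF : IsFastest μ F) (hb : 1 ≤ b)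
    (hμ : ∀ n, 0 ≤ μ n) (hσ : 0 ≤ σ) (hsub : ∑ n ∈ F, μ n + σ ≤ arrivalRate N α)
    (q : State N b) :
    generator α μ (fun q => waiting q * idle F q ^ 2 / 2) q ≤
      waiting q * (arrivalRate N α - σ * idle F q) := by
  have hw := waiting_nonneg q
  have hi := idle_nonneg F q
  have hS0 := singleRate_nonneg hμ F q
  have hS := (singleRate_le_sum hμ F q).trans (le_sub_iff_add_le.mpr hsub)
  have hΛ : 0 ≤ arrivalRate N α := by linarith
  by_cases h : idle F q = 0
  · have hgen := generator_le_of_idle_eq_zero (μ := μ) hb hΛ h fun w i => w * i ^ 2 / 2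
    simp only [zero_pow two_ne_zero, mul_zero, zero_div, sub_self, max_self] at hgen
    rw [h]
    nlinarith
  · have hgen := hF.generator_le_of_idle_ne_zero hb hΛ h fun w i => w * i ^ 2 / 2
    have hB : 0 ≤ queueRate μ q * idle F q ^ 2 := mul_nonneg (queueRate_nonneg hμ q) (sq_nonneg _)
    have hdrift : waiting q * (idle F q + 1 / 2) *
        (arrivalRate N α - σ - singleRate μ F q) ≥ 0 := by
      have := sub_nonneg.mpr hS
      positivity
    have hσw : 0 ≤ σ * waiting q := mul_nonneg hσ hw
    linear_combination hgen + hB / 2 + hdrift + hσw / 2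

theorem IsFastest.generator_exp_idle_le [NeZero N] (hF : IsFastest μ F) (hb : 1 ≤ b)
    (hμ : ∀ n, 0 ≤ μ n) {η : ℝ} (hη : 0 ≤ η) (hσ : 0 < σ) (hησ : 4 * η * arrivalRate N α ≤ σ)
    (hsub : ∑ n ∈ F, μ n + σ ≤ arrivalRate N α) (q : State N b) :
    generator α μ (fun q => Real.exp (η * idle F q)) q ≤
      η * (2 * arrivalRate N α - σ / 2 * Real.exp (η * idle F q)) := by
  have hS0 := singleRate_nonneg hμ F q
  have hS := (singleRate_le_sum hμ F q).trans (le_sub_iff_add_le.mpr hsub)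
  have hη1 : η ≤ 1 := by nlinarith
  have hup := exp_sub_one_le hη hη1
  have hdown := exp_neg_sub_one_le hη hη1
  by_cases h : idle F q = 0
  · have hgen := generator_le_of_idle_eq_zero (μ := μ) hb (by linarith) h
      fun _ i => Real.exp (η * i)
    simp only [h, sub_self, max_self, mul_zero, mul_one, Real.exp_zero, add_zero, zero_add]
      at hgen ⊢
    have hup' : singleRate μ F q * (Real.exp η - 1) ≤ (arrivalRate N α - σ) * (2 * η) :=
      mul_le_mul hS (by nlinarith) (by linarith [Real.add_one_le_exp η]) (by linarith)
    nlinarith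
  · have hgen := hF.generator_le_of_idle_ne_zero hb (by linarith) h fun _ i => Real.exp (η * i)
    have hi1 : 1 ≤ Real.exp (η * idle F q) :=
      Real.one_le_exp (mul_nonneg hη (idle_nonneg F q))
    set e := Real.exp (η * idle F q)
    have hrate : arrivalRate N α * (Real.exp (-η) - 1) + singleRate μ F q * (Real.exp η - 1) ≤
        -(η * σ / 2) := by
      have h1 := mul_le_mul_of_nonneg_left hdown (by linarith : 0 ≤ arrivalRate N α)
      have h2 := mul_le_mul_of_nonneg_left hup hS0
      nlinarith
    calc _ ≤ _ := hgen
      _ = e * (arrivalRate N α * (Real.exp (-η) - 1) + singleRate μ F q * (Real.exp η - 1)) := by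
        rw [show η * (idle F q - 1) = η * idle F q + -η by ring, mul_add, mul_one, Real.exp_add,
          Real.exp_add]
        ring
      _ ≤ e * -(η * σ / 2) := mul_le_mul_of_nonneg_left hrate (by linarith)
      _ ≤ _ := by nlinarith

theorem generator_exp_neg_idle_le_exp [NeZero N] (hb : 1 ≤ b) (hΛ : 0 ≤ arrivalRate N α) {θ : ℝ}
    (hθ : 0 ≤ θ) (q : State N b) :
    generator α μ (fun q => θ * waiting q + Real.exp (-(θ * idle Finset.univ q))) q ≤
      Real.exp (-(θ * idle Finset.univ q)) * (arrivalRate N α * (Real.exp θ - 1) +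
        singleRate μ Finset.univ q * (Real.exp (-θ) - 1)) - θ * queueRate μ q := by
  by_cases h : idle Finset.univ q = 0
  · have hgen := generator_le_of_idle_eq_zero (μ := μ) hb hΛ h
      fun w i => θ * w + Real.exp (-(θ * i))
    have hmax : max 0 (θ * (waiting q + 1) + Real.exp (-(θ * 0)) -
        (θ * waiting q + Real.exp (-(θ * 0)))) = θ := by
      rw [max_eq_right] <;> linarith
    have hexp := mul_le_mul_of_nonneg_left (Real.add_one_le_exp θ) hΛ
    rw [hmax] at hgen
    simp only [h, mul_zero, neg_zero, Real.exp_zero, mul_one, one_mul] at hgen ⊢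
    linarith
  · refine ((isFastest_univ μ).generator_le_of_idle_ne_zero hb hΛ h
      fun w i => θ * w + Real.exp (-(θ * i))).trans_eq ?_
    rw [show -(θ * (idle Finset.univ q - 1)) = -(θ * idle Finset.univ q) + θ by ring,
      show -(θ * (idle Finset.univ q + 1)) = -(θ * idle Finset.univ q) + -θ by ring,
      Real.exp_add, Real.exp_add]
    ring

theorem generator_exp_neg_idle_le [NeZero N] (hb : 1 ≤ b) (hμ : ∀ n, 0 ≤ μ n)
    (hΛ : 0 ≤ arrivalRate N α) (hD : 0 ≤ spareRate α μ) {θ : ℝ} (hθ0 : 0 ≤ θ) (hθ1 : θ ≤ 1)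
    (q : State N b) :
    generator α μ (fun q => θ * waiting q + Real.exp (-(θ * idle Finset.univ q))) q ≤
      θ * (Real.exp (-(θ * idle Finset.univ q)) *
        (idleRate μ q - spareRate α μ + 2 * θ * ∑ n, μ n)) := by
  have hgen := generator_exp_neg_idle_le_exp (μ := μ) hb hΛ hθ0 q
  set e := Real.exp (-(θ * idle Finset.univ q))
  have he0 : 0 ≤ e := (Real.exp_pos _).le
  have he1 : e ≤ 1 := Real.exp_le_one_iff.mpr (neg_nonpos.mpr (mul_nonneg hθ0 (idle_nonneg _ _)))
  have hS0 := singleRate_nonneg hμ Finset.univ q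
  have hB0 := queueRate_nonneg hμ q
  have hrate := idleRate_add_singleRate_add_queueRate μ q
  have hup := mul_le_mul_of_nonneg_left (exp_sub_one_le hθ0 hθ1) hΛ
  have hdown := mul_le_mul_of_nonneg_left (exp_neg_sub_one_le hθ0 hθ1) hS0
  rw [spareRate] at *
  have hquad : θ ^ 2 * (arrivalRate N α + singleRate μ Finset.univ q) ≤
      θ ^ 2 * (2 * ∑ n, μ n) := by
    gcongr
    linarith [idleRate_nonneg hμ q]
  calc _ ≤ _ := hgen
    _ ≤ e * (arrivalRate N α * (θ + θ ^ 2) + singleRate μ Finset.univ q * (-θ + θ ^ 2)) -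
        e * (θ * queueRate μ q) :=
      sub_le_sub (mul_le_mul_of_nonneg_left (add_le_add hup hdown) he0)
        (mul_le_of_le_one_left (mul_nonneg hθ0 hB0) he1)
    _ = e * (θ * (arrivalRate N α - singleRate μ Finset.univ q - queueRate μ q) +
        θ ^ 2 * (arrivalRate N α + singleRate μ Finset.univ q)) := by ring
    _ ≤ e * (θ * (arrivalRate N α - singleRate μ Finset.univ q - queueRate μ q) +
        θ ^ 2 * (2 * ∑ n, μ n)) := by gcongr
    _ = _ := by rw [← hrate]; ring

theorem generator_neg_waiting_le [NeZero N] (hb : 2 ≤ b) (hΛ : 0 ≤ arrivalRate N α)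
    (hμ : ∀ n, 0 ≤ μ n) (hD : 0 ≤ spareRate α μ) (q : State N b) :
    generator α μ (fun q => -waiting q) q ≤
      2 * queueRate μ q - arrivalRate N α * if idle Finset.univ q = 0 then 1 else 0 := by
  have hB := queueRate_nonneg hμ q
  by_cases h : idle Finset.univ q = 0 ∧ ∃ m, (q m : ℕ) < b
  · obtain ⟨h, m, hm⟩ := h
    have hgen := generator_le (F := Finset.univ) (μ := μ) (q := q) hΛ (fun w _ => -w) (a := -1)
      fun n hn => by
        have hnm : (q n : ℕ) ≤ q m := le_of_mem_targets hn m
        have hn1 := idle_eq_zero_iff.mp h n (Finset.mem_univ n)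
        rw [waiting_arrive, if_pos (by omega)]
        linarith
    rw [if_pos h]
    linarith
  · have hgen := generator_le (F := Finset.univ) (μ := μ) (q := q) hΛ (fun w _ => -w) (a := 0)
      fun n _ => by
        rw [waiting_arrive]
        split_ifs <;> linarith
    split_ifs with h0
    · have hfull : queueRate μ q = ∑ n, μ n := Finset.sum_congr rfl fun n _ =>
        if_pos (hb.trans (not_lt.mp fun hn => h ⟨h0, n, hn⟩))
      rw [spareRate] at hD
      linarith
    · linarith

end

/-! ### Stationary expectations -/

section

variable {N b : ℕ} {α σ ε c m : ℝ} {μ : Fin N → ℝ} {π : State N b → ℝ} {F : Finset (Fin N)}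

/-- The mean of `f` under the weights `π`, used for stationary `π`. -/
def expect (π f : State N b → ℝ) : ℝ := ∑ q, π q * f q

theorem expect_add (π f g : State N b → ℝ) :
    expect π (fun q => f q + g q) = expect π f + expect π g := by
  simp only [expect, mul_add, Finset.sum_add_distrib]

theorem expect_const_mul (π f : State N b → ℝ) (a : ℝ) :
    expect π (fun q => a * f q) = a * expect π f := by
  simp only [expect, mul_left_comm, Finset.mul_sum]

theorem expect_mono (hπ : ∀ q, 0 ≤ π q) {f g : State N b → ℝ} (h : ∀ q, f q ≤ g q) :
    expect π f ≤ expect π g :=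
  Finset.sum_le_sum fun q _ => mul_le_mul_of_nonneg_left (h q) (hπ q)

theorem expect_nonneg (hπ : ∀ q, 0 ≤ π q) {f : State N b → ℝ} (h : ∀ q, 0 ≤ f q) :
    0 ≤ expect π f :=
  Finset.sum_nonneg fun q _ => mul_nonneg (hπ q) (h q)

theorem IsStationary.expect_const (hπ : IsStationary α μ π) (a : ℝ) :
    expect π (fun _ => a) = a := by
  rw [expect, ← Finset.sum_mul, hπ.sum_eq_one, one_mul]

theorem IsStationary.expect_le_of_generator_le (hπ : IsStationary α μ π) {f g h : State N b → ℝ}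
    (hfg : ∀ q, generator α μ f q ≤ g q - h q) : expect π h ≤ expect π g := by
  have hbal : expect π (generator α μ f) = 0 := hπ.balance f
  calc expect π h = expect π (fun q => generator α μ f q + h q) := by
        rw [expect_add, hbal, zero_add]
    _ ≤ expect π g := expect_mono hπ.nonneg fun q => le_sub_iff_add_le.mp (hfg q)

theorem waitProb_eq_expect [NeZero N] (μ : Fin N → ℝ) (π : State N b → ℝ) :
    waitProb μ π = expect π fun q => if idle Finset.univ q = 0 then 1 else 0 := by
  refine Finset.sum_congr rfl fun q _ => ?_
  by_cases h : idle Finset.univ q = 0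
  · simp only [if_pos h, mul_one]
    refine (Finset.sum_congr rfl fun n hn => if_pos (Nat.one_le_iff_ne_zero.mpr
      (idle_eq_zero_iff.mp h n hn))).trans ?_
    rw [← Finset.mul_sum, sum_route, mul_one]
  · simp only [if_neg h, mul_zero]
    refine Finset.sum_eq_zero fun n _ => ?_
    by_cases hn : n ∈ targets μ q
    · simp [eq_zero_of_mem_targets hn h]
    · simp [route, hn]

theorem waitProb_nonneg [NeZero N] (hπ : ∀ q, 0 ≤ π q) : 0 ≤ waitProb μ π := by
  rw [waitProb_eq_expect]
  exact expect_nonneg hπ fun q => ite_nonneg zero_le_one le_rfl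

theorem idle_mul_spareRate_sub_idleRate_le (hε : 0 < ε) (hεμ : ∀ n, ε ≤ μ n) (α : ℝ)
    (q : State N b) :
    idle Finset.univ q * (spareRate α μ - idleRate μ q) ≤ spareRate α μ ^ 2 / (4 * ε) := by
  have hZ := mul_le_mul_of_nonneg_left (mul_idle_le_idleRate hεμ q) (idle_nonneg Finset.univ q)
  rw [le_div_iff₀ (by positivity)]
  nlinarith [sq_nonneg (spareRate α μ - 2 * ε * idle Finset.univ q)]

theorem IsStationary.expect_idle_mul_queueRate_le [NeZero N] (hπ : IsStationary α μ π)
    (hb : 1 ≤ b) (hε : 0 < ε) (hεμ : ∀ n, ε ≤ μ n) (hΛ : 0 ≤ arrivalRate N α)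
    (hD : 0 ≤ spareRate α μ) :
    expect π (fun q => idle Finset.univ q * queueRate μ q) ≤
      spareRate α μ ^ 2 / (4 * ε) + ∑ n, μ n := by
  rw [← hπ.expect_const (spareRate α μ ^ 2 / (4 * ε) + ∑ n, μ n)]
  refine hπ.expect_le_of_generator_le fun q =>
    (generator_idle_sq_le hb (fun n => hε.le.trans (hεμ n)) hΛ hD q).trans ?_
  have hi := idle_mul_spareRate_sub_idleRate_le hε hεμ α q
  linear_combination hi

theorem IsFastest.expect_waiting_mul_idle_le [NeZero N] (hF : IsFastest μ F)
    (hπ : IsStationary α μ π) (hb : 1 ≤ b) (hμ : ∀ n, 0 ≤ μ n) (hσ : 0 ≤ σ)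
    (hsub : ∑ n ∈ F, μ n + σ ≤ arrivalRate N α) :
    σ * expect π (fun q => waiting q * idle F q) ≤ arrivalRate N α * expect π waiting := by
  rw [← expect_const_mul, ← expect_const_mul]
  refine hπ.expect_le_of_generator_le fun q =>
    (hF.generator_waiting_mul_idle_sq_le hb hμ hσ hsub q).trans_eq ?_
  ring

theorem IsFastest.spareRate_mul_expect_waiting_le [NeZero N] (hF : IsFastest μ F)
    (hπ : IsStationary α μ π) (hb : 1 ≤ b) (hε : 0 < ε) (hεμ : ∀ n, ε ≤ μ n) (hc : 0 ≤ c)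
    (hFc : ∀ n ∉ F, μ n ≤ c) (hm0 : 0 ≤ m) (hm : ∀ n, μ n ≤ m) (hD : 0 ≤ spareRate α μ)
    (hσ : 0 < σ) (hsub : ∑ n ∈ F, μ n + σ ≤ arrivalRate N α)
    (hmσ : 2 * m * arrivalRate N α ≤ spareRate α μ * σ) :
    spareRate α μ * expect π waiting ≤
      2 * (c * b / ε + 1) * (spareRate α μ ^ 2 / (4 * ε) + ∑ n, μ n) := by
  have hμ : ∀ n, 0 ≤ μ n := fun n => hε.le.trans (hεμ n)
  have hΛ : 0 ≤ arrivalRate N α := by linarith [Finset.sum_nonneg fun n (_ : n ∈ F) => hμ n]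
  set D := spareRate α μ
  set K := D ^ 2 / (4 * ε) + ∑ n, μ n
  have hbalance : D * expect π waiting ≤
      K + c * b / ε * expect π (fun q => idle Finset.univ q * queueRate μ q) +
        m * expect π (fun q => waiting q * idle F q) := by
    rw [← expect_const_mul, ← expect_const_mul, ← expect_const_mul, ← hπ.expect_const K,
      ← expect_add, ← expect_add]
    refine hπ.expect_le_of_generator_le fun q =>
      (generator_waiting_sub_idle_sq_le hb hμ hΛ hD q).trans ?_
    have hi := idle_mul_spareRate_sub_idleRate_le hε hεμ α q
    have hwi : waiting q * idle Finset.univ q ≤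
        b / ε * (idle Finset.univ q * queueRate μ q) := by
      have := mul_le_mul_of_nonneg_right (mul_waiting_le hε.le hεμ q) (idle_nonneg Finset.univ q)
      rw [div_mul_eq_mul_div, le_div_iff₀ hε]
      linarith
    have hwZ := mul_le_mul_of_nonneg_left (idleRate_le hc hFc hm q) (waiting_nonneg q)
    have hcwi := mul_le_mul_of_nonneg_left hwi hc
    linear_combination hi + hwZ + hcwi
  have hiB := mul_le_mul_of_nonneg_left (hπ.expect_idle_mul_queueRate_le hb hε hεμ hΛ hD)
    (by positivity : 0 ≤ c * b / ε)
  have hwF : m * expect π (fun q => waiting q * idle F q) ≤ D * expect π waiting / 2 := by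
    have hw : 0 ≤ expect π waiting := expect_nonneg hπ.nonneg waiting_nonneg
    have hE := mul_le_mul_of_nonneg_left (hF.expect_waiting_mul_idle_le hπ hb hμ hσ.le hsub) hm0
    rw [← mul_le_mul_iff_right₀ hσ]
    nlinarith
  linarith

theorem IsStationary.arrivalRate_mul_waitProb_le [NeZero N] (hπ : IsStationary α μ π)
    (hb : 2 ≤ b) (hμ : ∀ n, 0 ≤ μ n) (hm0 : 0 ≤ m) (hm : ∀ n, μ n ≤ m)
    (hΛ : 0 ≤ arrivalRate N α) (hD : 0 ≤ spareRate α μ) :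
    arrivalRate N α * waitProb μ π ≤ 2 * m * expect π waiting := by
  rw [waitProb_eq_expect, ← expect_const_mul, ← expect_const_mul]
  refine hπ.expect_le_of_generator_le fun q =>
    (generator_neg_waiting_le hb hΛ hμ hD q).trans ?_
  linarith [queueRate_le hm0 hm q]

theorem IsFastest.expect_exp_idle_le [NeZero N] (hF : IsFastest μ F) (hπ : IsStationary α μ π)
    (hb : 1 ≤ b) (hμ : ∀ n, 0 ≤ μ n) {η : ℝ} (hη : 0 < η) (hσ : 0 < σ)
    (hησ : 4 * η * arrivalRate N α ≤ σ) (hsub : ∑ n ∈ F, μ n + σ ≤ arrivalRate N α) :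
    expect π (fun q => Real.exp (η * idle F q)) ≤ 4 * arrivalRate N α / σ := by
  have hE : expect π (fun q => η * σ / 2 * Real.exp (η * idle F q)) ≤
      expect π fun _ => η * (2 * arrivalRate N α) :=
    hπ.expect_le_of_generator_le fun q =>
      (hF.generator_exp_idle_le hb hμ hη.le hσ hησ hsub q).trans_eq (by ring)
  rw [expect_const_mul, hπ.expect_const] at hE
  rw [le_div_iff₀ hσ, ← mul_le_mul_iff_right₀ hη]
  linarith

theorem exp_neg_idle_mul_idleRate_le (hμ : ∀ n, 0 ≤ μ n) (hc : 0 < c)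
    (hFc : ∀ n ∉ F, μ n ≤ c) (hm0 : 0 < m) (hm : ∀ n, μ n ≤ m) {θ η D : ℝ} (hθ : 0 ≤ θ)
    (hη : 0 ≤ η) (hD : 0 ≤ D) (q : State N b) :
    Real.exp (-(θ * idle Finset.univ q)) * (idleRate μ q - 3 / 4 * D) ≤
      (∑ n, μ n) * Real.exp (-(θ * D / (2 * c))) +
          (∑ n, μ n) * Real.exp (-(η * D / (4 * m))) * Real.exp (η * idle F q) -
        3 / 4 * D * if idle Finset.univ q = 0 then 1 else 0 := by
  have hM : 0 ≤ ∑ n, μ n := Finset.sum_nonneg fun n _ => hμ n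
  have hZM : idleRate μ q ≤ ∑ n, μ n := by
    linarith [idleRate_add_singleRate_add_queueRate μ q, singleRate_nonneg hμ Finset.univ q,
      queueRate_nonneg hμ q]
  by_cases h : idle Finset.univ q = 0
  · simp only [h, idleRate_eq_zero h, mul_zero, neg_zero, Real.exp_zero, if_true]
    have : 0 ≤ (∑ n, μ n) * Real.exp (-(θ * D / (2 * c))) +
      (∑ n, μ n) * Real.exp (-(η * D / (4 * m))) * Real.exp (η * idle F q) := by positivity
    linarith
  rw [if_neg h, mul_zero, sub_zero]
  rcases le_total (idleRate μ q) (3 / 4 * D) with hZ | hZ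
  · exact (mul_nonpos_of_nonneg_of_nonpos (Real.exp_pos _).le (sub_nonpos.mpr hZ)).trans
      (by positivity)
  have hbound : Real.exp (-(θ * idle Finset.univ q)) ≤
      Real.exp (-(θ * D / (2 * c))) + Real.exp (-(η * D / (4 * m))) * Real.exp (η * idle F q) := by
    rw [← Real.exp_add]
    have hcases : D ≤ 2 * c * idle Finset.univ q ∨ D ≤ 4 * m * idle F q := by
      by_contra! hlt
      linarith [idleRate_le hc.le hFc hm q]
    rcases hcases with hi | hi
    · refine le_add_of_le_of_nonneg (Real.exp_le_exp.mpr (neg_le_neg ?_)) (Real.exp_pos _).le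
      rw [div_le_iff₀ (by positivity)]
      nlinarith
    · refine le_add_of_nonneg_of_le (Real.exp_pos _).le (Real.exp_le_exp.mpr ?_)
      have hηi : η * D / (4 * m) ≤ η * idle F q := by
        rw [div_le_iff₀ (by positivity)]
        nlinarith
      linarith [mul_nonneg hθ (idle_nonneg Finset.univ q)]
  calc _ ≤ Real.exp (-(θ * idle Finset.univ q)) * ∑ n, μ n := by gcongr; linarith
    _ ≤ _ := by linarith [mul_le_mul_of_nonneg_right hbound hM]

theorem IsFastest.spareRate_mul_waitProb_le [NeZero N] (hF : IsFastest μ F)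
    (hπ : IsStationary α μ π) (hb : 1 ≤ b) (hμ : ∀ n, 0 ≤ μ n) (hc : 0 < c)
    (hFc : ∀ n ∉ F, μ n ≤ c) (hm0 : 0 < m) (hm : ∀ n, μ n ≤ m) (hD : 0 < spareRate α μ) {η : ℝ}
    (hη : 0 < η) (hσ : 0 < σ) (hησ : 4 * η * arrivalRate N α ≤ σ)
    (hsub : ∑ n ∈ F, μ n + σ ≤ arrivalRate N α) :
    3 / 4 * spareRate α μ * waitProb μ π ≤
      (∑ n, μ n) * Real.exp (-(spareRate α μ ^ 2 / (16 * c * ∑ n, μ n))) +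
        (∑ n, μ n) * Real.exp (-(η * spareRate α μ / (4 * m))) * (4 * arrivalRate N α / σ) := by
  have hΛ : 0 ≤ arrivalRate N α := by linarith [Finset.sum_nonneg fun n (_ : n ∈ F) => hμ n]
  have hDM : spareRate α μ ≤ ∑ n, μ n := sub_le_self _ hΛ
  have hM : 0 < ∑ n, μ n := hD.trans_le hDM
  set D := spareRate α μ
  set M := ∑ n, μ n
  set θ := D / (8 * M)
  have hθ : 0 < θ := by positivity
  have hθ1 : θ ≤ 1 := (div_le_one (by positivity)).mpr (by linarith)
  have hθM : 2 * θ * M = D / 4 := by simp only [θ]; field_simp; norm_num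
  have hθD : θ * D / (2 * c) = D ^ 2 / (16 * c * M) := by simp only [θ]; field_simp; norm_num
  have hmean : expect π (fun q => θ * (3 / 4 * D * if idle Finset.univ q = 0 then 1 else 0)) ≤
      expect π fun q => θ * (M * Real.exp (-(θ * D / (2 * c))) +
        M * Real.exp (-(η * D / (4 * m))) * Real.exp (η * idle F q)) := by
    refine hπ.expect_le_of_generator_le fun q =>
      (generator_exp_neg_idle_le hb hμ hΛ hD.le hθ.le hθ1 q).trans ?_
    rw [← mul_sub]
    refine mul_le_mul_of_nonneg_left (le_trans (le_of_eq ?_)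
      (exp_neg_idle_mul_idleRate_le hμ hc hFc hm0 hm hθ.le hη.le hD.le q)) hθ.le
    rw [hθM]
    ring
  rw [expect_const_mul, expect_const_mul, expect_const_mul, expect_add, expect_const_mul,
    hπ.expect_const, expect_const_mul, ← waitProb_eq_expect, mul_le_mul_iff_right₀ hθ, hθD] at hmean
  exact hmean.trans (by gcongr; exact hF.expect_exp_idle_le hπ hb hμ hη hσ hησ hsub)

end

/-! ### The law of the waiting time -/

section

variable {N b : ℕ} {μ : Fin N → ℝ} {π : State N b → ℝ}

theorem toReal_gammaPDF_smul_self {a ρ : ℝ} (ha : 0 < a) (hρ : 0 < ρ) :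
    (fun x : ℝ => (gammaPDF a ρ x).toReal • x) = (Set.Ioi (0 : ℝ)).indicator fun x =>
      ρ ^ a / Real.Gamma a * (x ^ (a + 1 - 1) * Real.exp (-(ρ * x))) := by
  funext x
  rcases lt_or_ge 0 x with hx | hx
  · have hpdf : 0 ≤ ρ ^ a / Real.Gamma a * x ^ (a - 1) * Real.exp (-(ρ * x)) := by
      have := Real.Gamma_pos_of_pos ha
      positivity
    rw [gammaPDF_of_nonneg hx.le, ENNReal.toReal_ofReal hpdf,
      Set.indicator_of_mem (Set.mem_Ioi.mpr hx), add_sub_right_comm,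
      Real.rpow_add_one hx.ne', smul_eq_mul]
    ring
  · rw [Set.indicator_of_notMem (Set.notMem_Ioi.mpr hx)]
    rcases hx.lt_or_eq with hx | rfl
    · rw [gammaPDF_of_neg hx, ENNReal.toReal_zero, zero_smul]
    · rw [smul_zero]

theorem measurable_gammaPDF (a ρ : ℝ) : Measurable (gammaPDF a ρ) :=
  (measurable_gammaPDFReal a ρ).ennreal_ofReal

theorem integrable_id_gammaMeasure {a ρ : ℝ} (ha : 0 < a) (hρ : 0 < ρ) :
    Integrable (fun x : ℝ => x) (gammaMeasure a ρ) := by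
  rw [gammaMeasure, integrable_withDensity_iff_integrable_smul'
    (measurable_gammaPDF a ρ) (.of_forall fun _ => ENNReal.ofReal_lt_top),
    toReal_gammaPDF_smul_self ha hρ, integrable_indicator_iff measurableSet_Ioi]
  have h : IntegrableOn (fun x : ℝ => x ^ (a + 1 - 1) * Real.exp (-(ρ * x))) (Set.Ioi 0) := by
    simpa only [Real.rpow_one, neg_mul] using
      integrableOn_rpow_mul_exp_neg_mul_rpow (s := a + 1 - 1) (by linarith) one_pos hρ
  exact Integrable.const_mul h _

theorem integral_id_gammaMeasure {a ρ : ℝ} (ha : 0 < a) (hρ : 0 < ρ) :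
    ∫ x, x ∂(gammaMeasure a ρ) = a / ρ := by
  rw [gammaMeasure, integral_withDensity_eq_integral_toReal_smul
    (measurable_gammaPDF a ρ) (.of_forall fun _ => ENNReal.ofReal_lt_top),
    toReal_gammaPDF_smul_self ha hρ, integral_indicator measurableSet_Ioi, integral_const_mul,
    Real.integral_rpow_mul_exp_neg_mul_Ioi (by linarith) hρ, Real.Gamma_add_one ha.ne',
    one_div, Real.inv_rpow hρ.le, Real.rpow_add_one hρ.ne']
  have := (Real.Gamma_pos_of_pos ha).ne'
  have := (Real.rpow_pos_of_pos hρ a).ne'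
  field_simp

theorem integrable_eval_pi_expMeasure {k : ℕ} (i : Fin k) {ρ : ℝ} (hρ : 0 < ρ) :
    Integrable (fun s : Fin k → ℝ => s i) (Measure.pi fun _ => expMeasure ρ) :=
  have := isProbabilityMeasure_expMeasure hρ
  integrable_comp_eval (f := fun x : ℝ => x) (μ := fun _ => expMeasure ρ)
    (integrable_id_gammaMeasure one_pos hρ)

theorem integrable_erlang (k : ℕ) {ρ : ℝ} (hρ : 0 < ρ) :
    Integrable (fun x : ℝ => x) (erlang k ρ) := by
  rw [erlang, integrable_map_measure (by fun_prop) (by fun_prop)]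
  exact integrable_finsetSum _ fun i _ => integrable_eval_pi_expMeasure i hρ

theorem integral_erlang (k : ℕ) {ρ : ℝ} (hρ : 0 < ρ) : ∫ x, x ∂(erlang k ρ) = k / ρ := by
  have := isProbabilityMeasure_expMeasure hρ
  have hmean (i : Fin k) :
      ∫ s : Fin k → ℝ, s i ∂(Measure.pi fun _ => expMeasure ρ) = 1 / ρ :=
    (integral_comp_eval (f := fun x : ℝ => x) (μ := fun _ => expMeasure ρ) (by fun_prop)).trans
      (integral_id_gammaMeasure one_pos hρ)
  rw [erlang, integral_map (by fun_prop) (by fun_prop),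
    integral_finsetSum _ fun i _ => integrable_eval_pi_expMeasure i hρ]
  simp only [hmean, Finset.sum_const, Finset.card_univ, Fintype.card_fin, nsmul_eq_mul, mul_one_div]

theorem blockProb_le_waitProb (hb : 1 ≤ b) (hπ : ∀ q, 0 ≤ π q) :
    blockProb μ π ≤ waitProb μ π := by
  refine Finset.sum_le_sum fun q _ => Finset.sum_le_sum fun n _ => ?_
  by_cases h : (q n : ℕ) = b
  · rw [if_pos h, if_pos (hb.trans_eq h.symm)]
  · rw [if_neg h]
    exact ite_nonneg (mul_nonneg (hπ q) (route_nonneg μ q n)) le_rfl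

theorem integrable_waitLaw (hμ : ∀ n, 0 < μ n) (π : State N b → ℝ) :
    Integrable (fun w : ℝ => w) (waitLaw μ π) := by
  refine integrable_finsetSum_measure.mpr fun q _ =>
    integrable_finsetSum_measure.mpr fun n _ => ?_
  split_ifs
  · exact (integrable_erlang _ (hμ n)).smul_measure ENNReal.ofReal_ne_top
  · exact integrable_zero_measure

theorem integral_waitLaw (hμ : ∀ n, 0 < μ n) (hπ : ∀ q, 0 ≤ π q) (hB : blockProb μ π < 1) :
    ∫ w, w ∂(waitLaw μ π) = ∑ q, ∑ n, if (q n : ℕ) < b then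
      π q * route μ q n / (1 - blockProb μ π) * ((q n : ℕ) / μ n) else 0 := by
  have hint := integrable_finsetSum_measure.mp (integrable_waitLaw hμ π)
  rw [waitLaw, integral_finsetSum_measure hint]
  refine Finset.sum_congr rfl fun q hq => ?_
  rw [integral_finsetSum_measure (integrable_finsetSum_measure.mp (hint q hq))]
  refine Finset.sum_congr rfl fun n _ => ?_
  split_ifs
  · have hweight : 0 ≤ π q * route μ q n / (1 - blockProb μ π) :=
      div_nonneg (mul_nonneg (hπ q) (route_nonneg μ q n)) (sub_nonneg.mpr hB.le)
    rw [integral_smul_measure, integral_erlang _ (hμ n), ENNReal.toReal_ofReal hweight,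
      smul_eq_mul]
  · exact integral_zero_measure _

theorem integral_waitLaw_le {ε : ℝ} (hε : 0 < ε) (hεμ : ∀ n, ε ≤ μ n) (hπ : ∀ q, 0 ≤ π q)
    (hB : blockProb μ π < 1) :
    ∫ w, w ∂(waitLaw μ π) ≤ b / ε * waitProb μ π / (1 - blockProb μ π) := by
  have : 0 < 1 - blockProb μ π := sub_pos.mpr hB
  rw [integral_waitLaw (fun n => hε.trans_le (hεμ n)) hπ hB, waitProb, Finset.mul_sum,
    Finset.sum_div]
  refine Finset.sum_le_sum fun q _ => ?_
  rw [Finset.mul_sum, Finset.sum_div]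
  refine Finset.sum_le_sum fun n _ => ?_
  have hweight : 0 ≤ π q * route μ q n := mul_nonneg (hπ q) (route_nonneg μ q n)
  rcases Nat.eq_zero_or_pos (q n : ℕ) with h0 | h0
  · simp [h0]
  · rw [if_pos (show 1 ≤ (q n : ℕ) from h0)]
    split_ifs with hqb
    · have hmean : ((q n : ℕ) / μ n : ℝ) ≤ b / ε :=
        div_le_div₀ b.cast_nonneg (by exact_mod_cast hqb.le) hε (hεμ n)
      calc _ ≤ π q * route μ q n / (1 - blockProb μ π) * (b / ε) := by gcongr
        _ = _ := by ring
    · positivity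

end

/-! ### Bounds in the two regimes -/

section

variable {N b : ℕ} {α ε m : ℝ} {μ : Fin N → ℝ} {π : State N b → ℝ}

/-- The servers more than twice as fast as the average server. -/
def fast (μ : Fin N → ℝ) : Finset (Fin N) := Finset.univ.filter fun n => 2 < μ n

theorem isFastest_fast (μ : Fin N → ℝ) : IsFastest μ (fast μ) := by
  intro n hn k hk
  rw [fast, Finset.mem_filter_univ] at *
  linarith

theorem le_two_of_notMem_fast (n : Fin N) (hn : n ∉ fast μ) : μ n ≤ 2 := by
  rwa [fast, Finset.mem_filter_univ, not_lt] at hn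

theorem sum_fast_le (hε : 0 ≤ ε) (hεμ : ∀ n, ε ≤ μ n) (hsum : ∑ n, μ n = N) :
    ∑ n ∈ fast μ, μ n ≤ (1 - ε / 2) * N := by
  have hsplit : ∑ n ∈ fast μ, μ n + ∑ n ∈ (fast μ)ᶜ, μ n = N := by
    rw [Finset.sum_add_sum_compl, hsum]
  have hcard : ((fast μ).card : ℝ) + (fast μ)ᶜ.card = N := by
    exact_mod_cast (Finset.card_add_card_compl (fast μ)).trans (Fintype.card_fin N)
  have hfast : (fast μ).card * 2 ≤ ∑ n ∈ fast μ, μ n := by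
    rw [← nsmul_eq_mul]
    exact Finset.card_nsmul_le_sum _ _ _ fun n hn => (Finset.mem_filter.mp hn).2.le
  have hslow : (fast μ)ᶜ.card * ε ≤ ∑ n ∈ (fast μ)ᶜ, μ n := by
    rw [← nsmul_eq_mul]
    exact Finset.card_nsmul_le_sum _ _ _ fun n _ => hεμ n
  have hhalf : (N : ℝ) / 2 ≤ (fast μ)ᶜ.card := by
    have : 0 ≤ ∑ n ∈ (fast μ)ᶜ, μ n := Finset.sum_nonneg fun n _ => hε.trans (hεμ n)
    linarith
  linarith [mul_le_mul_of_nonneg_right hhalf hε]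

theorem le_one_of_sum_eq [NeZero N] (hεμ : ∀ n, ε ≤ μ n) (hsum : ∑ n, μ n = N) : ε ≤ 1 := by
  have h : Finset.univ.card • ε ≤ ∑ n, μ n := Finset.card_nsmul_le_sum _ _ _ fun n _ => hεμ n
  rw [hsum, Finset.card_univ, Fintype.card_fin, nsmul_eq_mul] at h
  exact (mul_le_iff_le_one_right (Nat.cast_pos.mpr (NeZero.pos N))).mp h

theorem spareRate_eq_rpow [NeZero N] (hsum : ∑ n, μ n = N) :
    spareRate α μ = (N : ℝ) ^ (1 - α) := by
  rw [spareRate, arrivalRate, load, hsum, sub_eq_add_neg 1 α,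
    Real.rpow_add (Nat.cast_pos.mpr (NeZero.pos N)), Real.rpow_one]
  ring

theorem arrivalRate_le (N : ℕ) (α : ℝ) : arrivalRate N α ≤ N :=
  mul_le_of_le_one_left N.cast_nonneg
    (sub_le_self _ (Real.rpow_nonneg N.cast_nonneg _))

theorem mul_le_arrivalRate {t : ℝ} (ht : (N : ℝ) ^ (-α) ≤ t) : (1 - t) * N ≤ arrivalRate N α :=
  mul_le_mul_of_nonneg_right (sub_le_sub_left ht 1) N.cast_nonneg

theorem sum_fast_add_le_arrivalRate (hε : 0 ≤ ε) (hεμ : ∀ n, ε ≤ μ n) (hsum : ∑ n, μ n = N)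
    (hα : (N : ℝ) ^ (-α) ≤ ε / 4) : ∑ n ∈ fast μ, μ n + ε * N / 4 ≤ arrivalRate N α := by
  linarith [sum_fast_le hε hεμ hsum, mul_le_arrivalRate hα]

theorem rpow_mul_expect_waiting_le [NeZero N] (hb : 1 ≤ b) (hε : 0 < ε) (hεμ : ∀ n, ε ≤ μ n)
    (hm : ∀ n, μ n ≤ m) (hsum : ∑ n, μ n = N) (hπ : IsStationary α μ π) (hα : 1 / 2 ≤ α)
    (hNα : (N : ℝ) ^ (-α) ≤ ε / 4) (hmN : 8 * m ≤ ε * (N : ℝ) ^ (1 - α)) :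
    (N : ℝ) ^ (1 - α) * expect π waiting ≤ 8 * b * N / ε ^ 2 := by
  have hN : (1 : ℝ) ≤ N := by exact_mod_cast NeZero.pos N
  have hb' : (1 : ℝ) ≤ b := by exact_mod_cast hb
  have hε1 : ε ≤ 1 := le_one_of_sum_eq hεμ hsum
  have hm0 : 0 < m := hε.trans_le ((hεμ 0).trans (hm 0))
  have hD : spareRate α μ = (N : ℝ) ^ (1 - α) := spareRate_eq_rpow hsum
  set D := (N : ℝ) ^ (1 - α)
  have hD0 : 0 ≤ D := Real.rpow_nonneg N.cast_nonneg _
  have hD_sq : D ^ 2 ≤ N := by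
    rw [← Real.rpow_mul_natCast N.cast_nonneg]
    exact Real.rpow_le_self_of_one_le hN (by push_cast; linarith)
  have hmσ : 2 * m * arrivalRate N α ≤ D * (ε * N / 4) := by
    nlinarith [mul_le_mul_of_nonneg_left (arrivalRate_le N α) hm0.le]
  have h := (isFastest_fast μ).spareRate_mul_expect_waiting_le hπ hb hε hεμ zero_le_two
    le_two_of_notMem_fast hm0.le hm (hD0.trans_eq hD.symm) (by positivity : 0 < ε * N / 4)
    (sum_fast_add_le_arrivalRate hε.le hεμ hsum hNα) (by rwa [hD])
  rw [hD, hsum] at h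
  have hbε : 2 * b / ε + 1 ≤ 3 * b / ε := by
    have : 1 ≤ b / ε := (one_le_div hε).mpr (hε1.trans hb')
    linarith [mul_div_assoc 2 (b : ℝ) ε, mul_div_assoc 3 (b : ℝ) ε]
  have hNε : D ^ 2 / (4 * ε) + N ≤ 5 / 4 * (N / ε) := by
    have : D ^ 2 / (4 * ε) ≤ N / (4 * ε) := by gcongr
    have : (N : ℝ) ≤ N / ε := le_div_self N.cast_nonneg hε hε1
    linarith [div_mul_eq_div_div_swap (N : ℝ) 4 ε]
  calc _ ≤ 2 * (3 * b / ε) * (5 / 4 * (N / ε)) := h.trans (by gcongr)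
    _ = 15 / 16 * (8 * b * N / ε ^ 2) := by field_simp; norm_num
    _ ≤ _ := mul_le_of_le_one_left (by positivity) (by norm_num)

theorem rpow_mul_waitProb_le [NeZero N] (hb : 2 ≤ b) (hε : 0 < ε) (hεμ : ∀ n, ε ≤ μ n)
    (hm : ∀ n, μ n ≤ m) (hsum : ∑ n, μ n = N) (hπ : IsStationary α μ π) (hα : 1 / 2 ≤ α)
    (hNα : (N : ℝ) ^ (-α) ≤ ε / 4) (hmN : 8 * m ≤ ε * (N : ℝ) ^ (1 - α)) :
    (N : ℝ) ^ (1 - α) * waitProb μ π ≤ 32 * b * m / ε ^ 2 := by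
  have hN : (0 : ℝ) < N := by exact_mod_cast NeZero.pos N
  have hm0 : 0 ≤ m := hε.le.trans ((hεμ 0).trans (hm 0))
  have hp : 0 ≤ waitProb μ π := waitProb_nonneg hπ.nonneg
  have hΛ : N / 2 ≤ arrivalRate N α := by
    nlinarith [mul_le_arrivalRate hNα, le_one_of_sum_eq hεμ hsum]
  have hD : 0 ≤ (N : ℝ) ^ (1 - α) := by positivity
  have hwait : N / 2 * waitProb μ π ≤ 2 * m * expect π waiting :=
    (mul_le_mul_of_nonneg_right hΛ hp).trans <|
      hπ.arrivalRate_mul_waitProb_le hb (fun n => hε.le.trans (hεμ n)) hm0 hm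
        (le_trans (by positivity) hΛ) (hD.trans_eq (spareRate_eq_rpow hsum).symm)
  refine le_of_mul_le_mul_left ?_ (by positivity : (0 : ℝ) < N / 2)
  calc N / 2 * ((N : ℝ) ^ (1 - α) * waitProb μ π)
      = (N : ℝ) ^ (1 - α) * (N / 2 * waitProb μ π) := by ring
    _ ≤ (N : ℝ) ^ (1 - α) * (2 * m * expect π waiting) := by gcongr
    _ = 2 * m * ((N : ℝ) ^ (1 - α) * expect π waiting) := by ring
    _ ≤ 2 * m * (8 * b * N / ε ^ 2) := by
      gcongr
      exact rpow_mul_expect_waiting_le (one_le_two.trans hb) hε hεμ hm hsum hπ hα hNα hmN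
    _ = N / 2 * (32 * b * m / ε ^ 2) := by ring

theorem rpow_mul_waitProb_le_exp [NeZero N] (hb : 1 ≤ b) (hε : 0 < ε) (hεμ : ∀ n, ε ≤ μ n)
    (hm : ∀ n, μ n ≤ m) (hsum : ∑ n, μ n = N) (hπ : IsStationary α μ π)
    (hNα : (N : ℝ) ^ (-α) ≤ ε / 4) (hmN : 128 * m * Real.log N ≤ ε * (N : ℝ) ^ (1 - α)) :
    3 / 4 * (N : ℝ) ^ (1 - α) * waitProb μ π ≤
      N * Real.exp (-((N : ℝ) ^ (1 - 2 * α) / 32)) + 16 / ε * (N : ℝ)⁻¹ := by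
  have hN : (0 : ℝ) < N := by exact_mod_cast NeZero.pos N
  have hm0 : 0 < m := hε.trans_le ((hεμ 0).trans (hm 0))
  have hD : spareRate α μ = (N : ℝ) ^ (1 - α) := spareRate_eq_rpow hsum
  have hΛ : arrivalRate N α ≤ N := arrivalRate_le N α
  have h := (isFastest_fast μ).spareRate_mul_waitProb_le hπ hb (fun n => hε.le.trans (hεμ n))
    zero_lt_two le_two_of_notMem_fast hm0 hm (by rw [hD]; positivity)
    (by positivity : 0 < ε / 16) (by positivity : 0 < ε * N / 4)
    (by linarith [mul_le_mul_of_nonneg_left hΛ hε.le])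
    (sum_fast_add_le_arrivalRate hε.le hεμ hsum hNα)
  rw [hD, hsum] at h
  have hD_sq : ((N : ℝ) ^ (1 - α)) ^ 2 / (16 * 2 * N) = (N : ℝ) ^ (1 - 2 * α) / 32 := by
    rw [← Real.rpow_mul_natCast hN.le,
      show (1 - α) * (2 : ℕ) = 1 - 2 * α + 1 by push_cast; ring, Real.rpow_add_one hN.ne']
    field_simp
    norm_num
  have hexp : Real.exp (-(ε / 16 * (N : ℝ) ^ (1 - α) / (4 * m))) ≤ ((N : ℝ) ^ 2)⁻¹ := by
    rw [Real.exp_neg]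
    gcongr
    rw [← Real.log_le_iff_le_exp (by positivity), Real.log_pow, le_div_iff₀ (by positivity)]
    push_cast
    linarith
  have hσ : 4 * arrivalRate N α / (ε * N / 4) ≤ 16 / ε := by
    rw [div_le_div_iff₀ (by positivity) hε]
    linarith [mul_le_mul_of_nonneg_left hΛ hε.le]
  refine h.trans (add_le_add (by rw [hD_sq]) ?_)
  calc _ ≤ N * Real.exp (-(ε / 16 * (N : ℝ) ^ (1 - α) / (4 * m))) * (16 / ε) := by gcongr
    _ ≤ N * ((N : ℝ) ^ 2)⁻¹ * (16 / ε) := by gcongr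
    _ = _ := by field_simp

/-- The chain blocks an arriving job with probability less than one, the waiting time of a job that
is not blocked has mean at most `A`, and a job has to wait with probability at most `B`. -/
def HasWaitBounds (μ : Fin N → ℝ) (π : State N b → ℝ) (A B : ℝ) : Prop :=
  blockProb μ π < 1 ∧ Integrable (fun w : ℝ => w) (waitLaw μ π) ∧
    ∫ w, w ∂(waitLaw μ π) ≤ A ∧ waitProb μ π ≤ B

theorem HasWaitBounds.mono {A B A' B' : ℝ} (h : HasWaitBounds μ π A B) (hA : A ≤ A')
    (hB : B ≤ B') : HasWaitBounds μ π A' B' :=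
  ⟨h.1, h.2.1, h.2.2.1.trans hA, h.2.2.2.trans hB⟩

theorem hasWaitBounds_of_mul_waitProb_le [NeZero N] {A : ℝ} (hb : 1 ≤ b) (hε : 0 < ε)
    (hεμ : ∀ n, ε ≤ μ n) (hsum : ∑ n, μ n = N) (hπ : ∀ q, 0 ≤ π q) (hA : A ≤ 1)
    (h : 2 * b / ε * waitProb μ π ≤ A) : HasWaitBounds μ π A A := by
  have hb' : (1 : ℝ) ≤ b := by exact_mod_cast hb
  have hp : 0 ≤ waitProb μ π := waitProb_nonneg hπ
  have hbε : 2 ≤ 2 * b / ε := by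
    rw [le_div_iff₀ hε]
    linarith [le_one_of_sum_eq hεμ hsum]
  have hpA : 2 * waitProb μ π ≤ A := (mul_le_mul_of_nonneg_right hbε hp).trans h
  have hB : blockProb μ π ≤ 1 / 2 := (blockProb_le_waitProb hb hπ).trans (by linarith)
  refine ⟨by linarith, integrable_waitLaw (fun n => hε.trans_le (hεμ n)) π, ?_, by linarith⟩
  calc _ ≤ b / ε * waitProb μ π / (1 - blockProb μ π) :=
        integral_waitLaw_le hε hεμ hπ (by linarith)
    _ ≤ b / ε * waitProb μ π / (1 / 2) := by
        gcongr
        linarith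
    _ = 2 * b / ε * waitProb μ π := by ring
    _ ≤ A := h

theorem tendsto_mul_exp_neg_rpow {β : ℝ} (hβ : 0 < β) :
    Filter.Tendsto (fun x : ℝ => x * Real.exp (-(x ^ β / 32))) Filter.atTop (nhds 0) := by
  have h := (tendsto_rpow_mul_exp_neg_mul_atTop_nhds_zero β⁻¹ (1 / 32) (by norm_num)).comp
    (tendsto_rpow_atTop hβ)
  refine h.congr' ?_
  filter_upwards [Filter.eventually_ge_atTop 0] with x hx
  rw [Function.comp_apply, Real.rpow_rpow_inv hx hβ.ne', neg_mul, one_div_mul_eq_div]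

theorem hasWaitBounds_of_lt_half [NeZero N] (hb : 1 ≤ b) (hε : 0 < ε) (hεμ : ∀ n, ε ≤ μ n)
    (hm : ∀ n, μ n ≤ m) (hsum : ∑ n, μ n = N) (hπ : IsStationary α μ π) (hα : α < 1 / 2)
    (hNα : (N : ℝ) ^ (-α) ≤ ε / 4) (hmN : 128 * m * Real.log N ≤ ε * (N : ℝ) ^ (1 - α))
    (hsmall : N * Real.exp (-((N : ℝ) ^ (1 - 2 * α) / 32)) + 16 / ε * (N : ℝ)⁻¹ ≤
      3 * ε / (8 * b)) :
    HasWaitBounds μ π (1 / Real.sqrt N) (1 / Real.sqrt N) := by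
  have hN : (1 : ℝ) ≤ N := by exact_mod_cast NeZero.pos N
  have hp : 0 ≤ waitProb μ π := waitProb_nonneg hπ.nonneg
  have hsqrt : 1 ≤ Real.sqrt N := Real.one_le_sqrt.mpr hN
  have hD : Real.sqrt N ≤ (N : ℝ) ^ (1 - α) := by
    rw [Real.sqrt_eq_rpow]
    exact Real.rpow_le_rpow_of_exponent_le hN (by linarith)
  refine hasWaitBounds_of_mul_waitProb_le hb hε hεμ hsum hπ.nonneg
    (div_le_one_of_le₀ hsqrt (by positivity)) ?_
  have h := (rpow_mul_waitProb_le_exp hb hε hεμ hm hsum hπ hNα hmN).trans hsmall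
  rw [le_div_iff₀ (by positivity)]
  calc 2 * b / ε * waitProb μ π * Real.sqrt N
      ≤ 2 * b / ε * waitProb μ π * (N : ℝ) ^ (1 - α) := by gcongr
    _ = 8 * b / (3 * ε) * (3 / 4 * (N : ℝ) ^ (1 - α) * waitProb μ π) := by field_simp; ring
    _ ≤ 8 * b / (3 * ε) * (3 * ε / (8 * b)) := by gcongr
    _ = 1 := by field_simp

theorem hasWaitBounds_of_half_le [NeZero N] {δ : ℝ} (hb : 2 ≤ b) (hε : 0 < ε)
    (hεμ : ∀ n, ε ≤ μ n) (hm : ∀ n, μ n ≤ m) (hsum : ∑ n, μ n = N) (hπ : IsStationary α μ π)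
    (hα : 1 / 2 ≤ α) (hNα : (N : ℝ) ^ (-α) ≤ ε / 4)
    (hmN : 8 * m ≤ ε * (N : ℝ) ^ (1 - α)) (hδN : δ * m * Real.log N ≤ (N : ℝ) ^ (1 - α))
    (hsmall : 64 * b ^ 2 / ε ^ 3 ≤ δ * Real.log N) :
    HasWaitBounds μ π (δ * m * Real.log N / (N : ℝ) ^ (1 - α))
      (δ * m * Real.log N / (N : ℝ) ^ (1 - α)) := by
  have hD : 0 < (N : ℝ) ^ (1 - α) := by have := NeZero.pos N; positivity
  have hm0 : 0 < m := hε.trans_le ((hεμ 0).trans (hm 0))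
  refine hasWaitBounds_of_mul_waitProb_le (one_le_two.trans hb) hε hεμ hsum hπ.nonneg
    (div_le_one_of_le₀ hδN hD.le) ?_
  rw [le_div_iff₀ hD]
  calc 2 * b / ε * waitProb μ π * (N : ℝ) ^ (1 - α)
      = 2 * b / ε * ((N : ℝ) ^ (1 - α) * waitProb μ π) := by ring
    _ ≤ 2 * b / ε * (32 * b * m / ε ^ 2) := by
      gcongr
      exact rpow_mul_waitProb_le hb hε hεμ hm hsum hπ hα hNα hmN
    _ = 64 * b ^ 2 / ε ^ 3 * m := by field_simp; norm_num
    _ ≤ δ * Real.log N * m := by gcongr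
    _ = δ * m * Real.log N := by ring

end

/-! ### Large systems -/

section

variable {N b : ℕ} {α r ε : ℝ}

theorem eventually_mul_exp_neg_rpow_add_le {δ : ℝ} (hα : α < 1 / 2) (c : ℝ) (hδ : 0 < δ) :
    ∀ᶠ N : ℕ in Filter.atTop,
      N * Real.exp (-((N : ℝ) ^ (1 - 2 * α) / 32)) + c * (N : ℝ)⁻¹ ≤ δ := by
  have h := (tendsto_mul_exp_neg_rpow (by linarith : 0 < 1 - 2 * α)).add
    (tendsto_inv_atTop_zero.const_mul c)
  rw [mul_zero, add_zero] at h
  exact (h.comp tendsto_natCast_atTop_atTop).eventually_le_const hδ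

theorem mul_mul_le_of_mul_sq_le {c t x l K D : ℝ} (hc : 0 ≤ c) (hl : 0 < l) (hD : 0 ≤ D)
    (h : x * l ^ 2 ≤ K * D) (hcK : c * K ≤ t * l) : c * x * l ≤ t * D := by
  refine le_of_mul_le_mul_right ?_ hl
  calc c * x * l * l = c * (x * l ^ 2) := by ring
    _ ≤ c * (K * D) := by gcongr
    _ = c * K * D := by ring
    _ ≤ t * l * D := by gcongr
    _ = t * D * l := by ring

theorem one_le_log_natCast (hN : 3 ≤ N) : 1 ≤ Real.log N :=
  (Real.le_log_iff_exp_le (by positivity)).mpr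
    (Real.exp_one_lt_three.le.trans (by exact_mod_cast hN))

theorem one_div_sqrt_le_one_div_rpow [NeZero N] (hα : α ≤ 1 / 2) :
    1 / Real.sqrt N ≤ 1 / (N : ℝ) ^ α := by
  have hN : (1 : ℝ) ≤ N := by exact_mod_cast NeZero.pos N
  rw [Real.sqrt_eq_rpow]
  gcongr

theorem Rates.le_zero [NeZero N] {μ : Fin N → ℝ} {n₂ : Fin N} (h : Rates α ε μ n₂) (n : Fin N) :
    μ n ≤ μ 0 :=
  h.antitone (Fin.zero_le n)

theorem SubAssumption.mul_log_sq_le {m : ℝ} (h : SubAssumption N b α r ε m) (hb : 1 ≤ b)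
    (hε : 0 < ε) : m * Real.log N ^ 2 ≤ ε ^ 2 * (N : ℝ) ^ (1 - α) := by
  have hb' : (1 : ℝ) ≤ b := by exact_mod_cast hb
  have hc : 0 < 64 * b * (2 * Real.log N ^ 2 + 3) := by positivity
  have hlog : Real.log N ^ 2 ≤ 64 * b * (2 * Real.log N ^ 2 + 3) := by
    nlinarith [sq_nonneg (Real.log N)]
  have hm : m ≤ (N : ℝ) ^ (1 - α) / (64 * b * (2 * Real.log N ^ 2 + 3)) * ε ^ 2 :=
    (div_le_iff₀ (by positivity)).mp h.fastest
  calc _ ≤ (N : ℝ) ^ (1 - α) / (64 * b * (2 * Real.log N ^ 2 + 3)) * ε ^ 2 * Real.log N ^ 2 := by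
        gcongr
    _ = Real.log N ^ 2 / (64 * b * (2 * Real.log N ^ 2 + 3)) * (ε ^ 2 * (N : ℝ) ^ (1 - α)) := by
        ring
    _ ≤ _ := mul_le_of_le_one_left (by positivity) ((div_le_one hc).mpr hlog)

theorem SuperAssumption.mul_log_sq_le {m : ℝ} (h : SuperAssumption N b α r ε m)
    (hb : 1 ≤ b) (hr : 0 < r) (hε : 0 < ε) : m * Real.log N ^ 2 ≤ ε / r * (N : ℝ) ^ (1 - α) := by
  have hb' : (1 : ℝ) ≤ b := by exact_mod_cast hb
  have hm : m ≤ (N : ℝ) ^ (1 - α) / (24 * r * b * Real.log N ^ 2) * ε :=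
    (div_le_iff₀ hε).mp h.fastest
  rcases eq_or_ne (Real.log N) 0 with hlog | hlog
  · rw [hlog, zero_pow two_ne_zero, mul_zero]
    positivity
  · calc _ ≤ (N : ℝ) ^ (1 - α) / (24 * r * b * Real.log N ^ 2) * ε * Real.log N ^ 2 := by gcongr
      _ = (24 * b : ℝ)⁻¹ * (ε / r * (N : ℝ) ^ (1 - α)) := by field_simp
      _ ≤ _ := mul_le_of_le_one_left (by positivity) (inv_le_one_of_one_le₀ (by linarith))

theorem kSub_nonneg {m : ℝ} (hb : 1 ≤ b) (hm : 0 ≤ m) : 0 ≤ kSub b ε m := by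
  have : (0 : ℝ) ≤ b - 1 := sub_nonneg.mpr (by exact_mod_cast hb)
  rw [kSub]
  positivity

theorem kSuper_eq_mul (b : ℕ) (r ε m : ℝ) : kSuper b r ε m = 24 * r * (b - 1) / ε * m := by
  rw [kSuper]
  ring

theorem eventually_rpow_neg_natCast_le {x : ℝ} (hα : 0 < α) (hx : 0 < x) :
    ∀ᶠ N : ℕ in Filter.atTop, (N : ℝ) ^ (-α) ≤ x :=
  ((tendsto_rpow_neg_atTop hα).comp tendsto_natCast_atTop_atTop).eventually_le_const hx

theorem eventually_le_mul_log_natCast (x : ℝ) {y : ℝ} (hy : 0 < y) :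
    ∀ᶠ N : ℕ in Filter.atTop, x ≤ y * Real.log N :=
  ((Real.tendsto_log_atTop.comp tendsto_natCast_atTop_atTop).const_mul_atTop
    hy).eventually_ge_atTop x

theorem eventually_hasWaitBounds_of_lt_half (hα : 0 < α) (hα' : α < 1 / 2) (hb : 1 ≤ b)
    (hε : 0 < ε) (K : ℝ) :
    ∀ᶠ N : ℕ in Filter.atTop, ∀ [NeZero N] (μ : Fin N → ℝ) (m : ℝ) (π : State N b → ℝ),
      (∀ n, ε ≤ μ n) → (∀ n, μ n ≤ m) → ∑ n, μ n = N → IsStationary α μ π →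
        m * Real.log N ^ 2 ≤ K * (N : ℝ) ^ (1 - α) →
          HasWaitBounds μ π (1 / Real.sqrt N) (1 / Real.sqrt N) := by
  have hδ : 0 < 3 * ε / (8 * b) := by positivity
  filter_upwards [eventually_rpow_neg_natCast_le hα (by positivity : 0 < ε / 4),
    eventually_le_mul_log_natCast 1 one_pos, eventually_le_mul_log_natCast (128 * K) hε,
    eventually_mul_exp_neg_rpow_add_le hα' (16 / ε) hδ]
    with N hNα hlog1 hlogK hsmall _ μ m π hεμ hm hsum hπ hK
  exact hasWaitBounds_of_lt_half hb hε hεμ hm hsum hπ hα' hNα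
    (mul_mul_le_of_mul_sq_le (by norm_num) (by linarith) (by positivity) hK hlogK) hsmall

theorem eventually_hasWaitBounds_of_half_le {δ : ℝ} (hα : 1 / 2 ≤ α) (hb : 2 ≤ b)
    (hε : 0 < ε) (hδ : 0 < δ) (K : ℝ) :
    ∀ᶠ N : ℕ in Filter.atTop, ∀ [NeZero N] (μ : Fin N → ℝ) (m : ℝ) (π : State N b → ℝ),
      (∀ n, ε ≤ μ n) → (∀ n, μ n ≤ m) → ∑ n, μ n = N → IsStationary α μ π →
        m * Real.log N ^ 2 ≤ K * (N : ℝ) ^ (1 - α) →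
          HasWaitBounds μ π (δ * m * Real.log N / (N : ℝ) ^ (1 - α))
            (δ * m * Real.log N / (N : ℝ) ^ (1 - α)) := by
  filter_upwards [eventually_rpow_neg_natCast_le (by linarith : 0 < α) (by positivity : 0 < ε / 4),
    eventually_le_mul_log_natCast 1 one_pos, eventually_le_mul_log_natCast (8 * K) hε,
    eventually_le_mul_log_natCast (δ * K) one_pos,
    eventually_le_mul_log_natCast (64 * b ^ 2 / ε ^ 3) hδ]
    with N hNα hlog1 hlogK hlogδK hlogδ _ μ m π hεμ hm hsum hπ hK
  rw [one_mul] at hlog1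
  have hm0 : 0 ≤ m := hε.le.trans ((hεμ 0).trans (hm 0))
  have hcond {c t : ℝ} (hc : 0 ≤ c) (h : c * K ≤ t * Real.log N) :
      c * m * Real.log N ≤ t * (N : ℝ) ^ (1 - α) :=
    mul_mul_le_of_mul_sq_le hc (one_pos.trans_le hlog1) (by positivity) hK h
  have hmN : 8 * m ≤ ε * (N : ℝ) ^ (1 - α) :=
    (le_mul_of_one_le_right (by positivity) hlog1).trans (hcond (by norm_num) hlogK)
  exact hasWaitBounds_of_half_le hb hε hεμ hm hsum hπ hα hNα hmN
    ((hcond hδ.le hlogδK).trans_eq (one_mul _)) hlogδ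

end

end JFSQ

end

theorem theorem1_general {b : ℕ} {α ε δ : ℝ} (hα : 0 < α) (hb : 2 ≤ b) (hε : 0 < ε)
    (hδ : 0 < δ) (K : ℝ) :
    ∃ N₀ : ℕ, ∀ (N : ℕ) [NeZero N], N₀ ≤ N →
      ∀ (μ : Fin N → ℝ) (m : ℝ) (π : JFSQ.State N b → ℝ),
        (∀ n, ε ≤ μ n) → (∀ n, μ n ≤ m) → ∑ n, μ n = N → JFSQ.IsStationary α μ π →
          m * Real.log N ^ 2 ≤ K * (N : ℝ) ^ (1 - α) →
            (α < 1 / 2 → JFSQ.HasWaitBounds μ π (1 / Real.sqrt N) (1 / Real.sqrt N)) ∧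
            (1 / 2 ≤ α → JFSQ.HasWaitBounds μ π (δ * m * Real.log N / (N : ℝ) ^ (1 - α))
              (δ * m * Real.log N / (N : ℝ) ^ (1 - α))) := by
  rcases lt_or_ge α (1 / 2) with hα' | hα'
  · obtain ⟨N₀, hN₀⟩ := Filter.eventually_atTop.mp
      (JFSQ.eventually_hasWaitBounds_of_lt_half hα hα' (one_le_two.trans hb) hε K)
    exact ⟨N₀, fun N _ hN μ m π hεμ hm hsum hπ hK =>
      ⟨fun _ => hN₀ N hN μ m π hεμ hm hsum hπ hK, fun h => absurd hα' h.not_gt⟩⟩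
  · obtain ⟨N₀, hN₀⟩ := Filter.eventually_atTop.mp
      (JFSQ.eventually_hasWaitBounds_of_half_le hα' hb hε hδ K)
    exact ⟨N₀, fun N _ hN μ m π hεμ hm hsum hπ hK =>
      ⟨fun h => absurd h hα'.not_gt, fun _ => hN₀ N hN μ m π hεμ hm hsum hπ hK⟩⟩

theorem theorem1 (r : ℝ) (hr : 0 < r) :
    ∃ C : ℝ, 0 < C ∧
      ∀ (α : ℝ) (b : ℕ) (ε : ℝ), 0 < α → α < 1 → 2 ≤ b → 0 < ε →
        ∃ N₀ : ℕ, ∀ (N : ℕ) [NeZero N], N₀ ≤ N →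
          ∀ (μ : Fin N → ℝ) (n₂ : Fin N) (π : JFSQ.State N b → ℝ),
            JFSQ.Rates α ε μ n₂ → JFSQ.IsStationary α μ π →
              (JFSQ.SubAssumption N b α r ε (μ 0) →
                JFSQ.blockProb μ π < 1 ∧
                MeasureTheory.Integrable (fun w : ℝ => w) (JFSQ.waitLaw μ π) ∧
                ∫ w, w ∂(JFSQ.waitLaw μ π) ≤
                  C * (1 / (N : ℝ) ^ α + JFSQ.kSub b ε (μ n₂) / (N : ℝ) ^ (1 - α)) ∧
                JFSQ.waitProb μ π ≤
                  C * (JFSQ.kSub b ε (μ n₂) / (N : ℝ) ^ (1 - α) +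
                    Real.log N / Real.sqrt N)) ∧
              (JFSQ.SuperAssumption N b α r ε (μ 0) →
                JFSQ.blockProb μ π < 1 ∧
                MeasureTheory.Integrable (fun w : ℝ => w) (JFSQ.waitLaw μ π) ∧
                ∫ w, w ∂(JFSQ.waitLaw μ π) ≤
                  C * (JFSQ.kSuper b r ε (μ 0) * Real.log N / (N : ℝ) ^ (1 - α) +
                    Real.log N / Real.sqrt N) ∧
                JFSQ.waitProb μ π ≤
                  C * (JFSQ.kSuper b r ε (μ 0) * Real.log N / (N : ℝ) ^ (1 - α))) := by
  refine ⟨1, one_pos, fun α b ε hα _ hb hε => ?_⟩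
  have hb1 : 1 ≤ b := one_le_two.trans hb
  have hδ : 0 < 24 * r * (b - 1) / ε :=
    div_pos (mul_pos (by positivity) (sub_pos.mpr (by exact_mod_cast hb))) hε
  obtain ⟨N₁, hsub⟩ := theorem1_general hα hb hε hδ (ε ^ 2)
  obtain ⟨N₂, hsuper⟩ := theorem1_general hα hb hε hδ (ε / r)
  refine ⟨max (max N₁ N₂) 3, fun N _ hN μ n₂ π hR hπ => ?_⟩
  simp only [max_le_iff] at hN
  obtain ⟨⟨hN₁, hN₂⟩, hN₃⟩ := hN
  have hlog : 1 ≤ Real.log N := JFSQ.one_le_log_natCast hN₃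
  have hk : 0 ≤ JFSQ.kSub b ε (μ n₂) / (N : ℝ) ^ (1 - α) :=
    div_nonneg (JFSQ.kSub_nonneg hb1 (hε.le.trans (hR.lower n₂))) (by positivity)
  simp only [one_mul]
  refine ⟨fun hA => ?_, fun hA => ?_⟩
  · exact ((hsub N hN₁ μ (μ 0) π hR.lower hR.le_zero hR.total hπ
      (hA.mul_log_sq_le hb1 hε)).1 hA.regime.2).mono
      (le_add_of_le_of_nonneg (JFSQ.one_div_sqrt_le_one_div_rpow hA.regime.2.le) hk)
      (le_add_of_nonneg_of_le hk (by gcongr))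
  · rw [JFSQ.kSuper_eq_mul]
    exact ((hsuper N hN₂ μ (μ 0) π hR.lower hR.le_zero hR.total hπ
      (hA.mul_log_sq_le hb1 hr hε)).2 hA.regime.1).mono
      (le_add_of_nonneg_right (by positivity)) le_rfl
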